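/- Let $F,G\in\mathbb{R}[x_0,x_1,x_2,x_3]$ be homogeneous polynomials that are irreducible over $\mathbb{C}$. Let $R,S\subset\mathbb{P}^3_{\mathbb{R}}$ be the real surfaces $F=0$ and $G=0$, and let $R_{\mathbb{C}},S_{\mathbb{C}}\subset\mathbb{P}^3_{\mathbb{C}}$ be the complex zero loci of $F$ and $G$. Assume that $\dim_{\mathbb{R}}R=\dim_{\mathbb{R}}S=2$, where the dimension of a real projective algebraic set $X\subset\mathbb{P}^3_{\mathbb{R}}$ is one less than the Krull dimension of $\mathbb{R}[x_0,x_1,x_2,x_3]/I(X)$, with $I(X)$ the ideal of all real polynomials vanishing on the affine cone over $X$. A similarity is a real projective transformation of $\mathbb{P}^3$ given by a matrix $\begin{pmatrix}1&0\\ a&A\end{pmatrix}$ with $a\in\mathbb{R}^3$, $A\in\mathbb{R}^{3\times 3}$ and $A^{\top}A=\lambda I$ for some real $\lambda>0$; it is direct if $\det A>0$. Similarities act on both $\mathbb{P}^3_{\mathbb{R}}$ and $\mathbb{P}^3_{\mathbb{C}}$. Let $\mathrm{Sim}$ be the group of direct similarities and, for subsets $X,Y$ of $\mathbb{P}^3_{\mathbb{R}}$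 or of $\mathbb{P}^3_{\mathbb{C}}$, put $\mathrm{Sim}_{X,Y}=\{\phi\in\mathrm{Sim}:\phi(X)=Y\}$. Then $$\mathrm{Sim}_{R_{\mathbb{C}},S_{\mathbb{C}}}=\mathrm{Sim}_{R,S}.$$ The same equality holds with the group of all similarities, direct or not, in place of $\mathrm{Sim}$. -/

import Mathlib

open scoped LinearAlgebra.Projectivization MatrixGroups Pointwise

noncomputable section

namespace SimSurf

/-- Projective 3-space over a field `K`, with homogeneous coordinates `[x₀ : x₁ : x₂ : x₃]`;
the plane at infinity is `x₀ = 0`. -/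
abbrev P3 (K : Type*) [Field K] : Type _ := ℙ K (Fin 4 → K)

/-- A real projective transformation acts on complex projective space through the inclusion
`PGL(4, ℝ) → PGL(4, ℂ)`. -/
instance : MulAction PGL(4, ℝ) (P3 ℂ) :=
  MulAction.compHom _ (Matrix.ProjGenLinGroup.map Complex.ofRealHom)

/-- The set of equivalences `𝓖_{A,B} = {φ ∈ 𝓖 : φ(A) = B}` between two subsets `A`, `B` of a space
on which the transformations act. -/
def equivalences {T X : Type*} [Group T] [MulAction T X] (𝓖 : Set T) (A B : Set X) : Set T :=
  {φ | φ ∈ 𝓖 ∧ φ • A = B}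

/-- The zero locus of a homogeneous polynomial in projective 3-space. -/
def zeroLocus {K : Type*} [Field K] (F : MvPolynomial (Fin 4) K) : Set (P3 K) :=
  {p | ∀ (v : Fin 4 → K) (hv : v ≠ 0), Projectivization.mk K v hv = p → MvPolynomial.eval v F = 0}

/-- The linear part, on the affine chart `x₀ = 1`, of the transformation with matrix `M`
(meaningful if the first row of `M` is `(a₀₀, 0, 0, 0)` with `a₀₀ ≠ 0`). -/
def linearPart (M : Matrix (Fin 4) (Fin 4) ℝ) : Matrix (Fin 3) (Fin 3) ℝ :=
  (M 0 0)⁻¹ • M.submatrix Fin.succ Fin.succ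

/-- The matrix `M` represents a similarity: it maps the plane at infinity to itself (that is, its
first row is `(a₀₀, 0, 0, 0)` with `a₀₀ ≠ 0`), and its linear part `A` satisfies `Aᵀ A = c I`
for some `c > 0`. -/
def IsSimilarityMatrix (M : Matrix (Fin 4) (Fin 4) ℝ) : Prop :=
  M 0 0 ≠ 0 ∧ (∀ j : Fin 3, M 0 j.succ = 0) ∧
    ∃ c : ℝ, 0 < c ∧ (linearPart M).transpose * linearPart M = c • (1 : Matrix (Fin 3) (Fin 3) ℝ)

/-- The similarities of Euclidean 3-space, as real projective transformations. -/
def similarities : Set PGL(4, ℝ) :=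
  {φ | ∃ g : GL (Fin 4) ℝ, Matrix.ProjGenLinGroup.mk g = φ ∧ IsSimilarityMatrix g.val}

/-- The direct (orientation preserving) similarities of Euclidean 3-space. -/
def directSimilarities : Set PGL(4, ℝ) :=
  {φ | ∃ g : GL (Fin 4) ℝ, Matrix.ProjGenLinGroup.mk g = φ ∧ IsSimilarityMatrix g.val ∧
    0 < (linearPart g.val).det}

/-- The set of nonzero vectors that represent a point of `X` (the affine cone over `X` without
its vertex). -/
def coneOver (X : Set (P3 ℝ)) : Set (Fin 4 → ℝ) :=
  {v | ∃ hv : v ≠ 0, Projectivization.mk ℝ v hv ∈ X}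

/-- The real dimension of a real projective algebraic set `X` is `d`: the Krull dimension of its
homogeneous coordinate ring `ℝ[x₀, x₁, x₂, x₃] / I(X)`, where `I(X)` is the ideal of all real
polynomials that vanish at the real points of `X`, is `d + 1`. -/
def HasRealDim (X : Set (P3 ℝ)) (d : ℕ) : Prop :=
  ringKrullDim (MvPolynomial (Fin 4) ℝ ⧸ MvPolynomial.vanishingIdeal ℝ (coneOver X)) = d + 1

/-- The real surface given by `F`: the set of real points at which `F` vanishes. -/
def realSurface (F : MvPolynomial (Fin 4) ℝ) : Set (P3 ℝ) := zeroLocus F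

/-- The zero locus of `F` in complex projective 3-space. -/
def complexSurface (F : MvPolynomial (Fin 4) ℝ) : Set (P3 ℂ) :=
  zeroLocus (MvPolynomial.map (algebraMap ℝ ℂ) F)

end SimSurf

end

/-!
The real points of a surface `F = 0` of real dimension 2 determine `F` up to scalars. Indeed the
vanishing ideal `I(R)` contains the prime ideal `(F)`, and `ℝ[x]/I(R)` has Krull dimension `3`,
just as `ℝ[x]/(F)`; a strictly larger ideal would lower the dimension, so `I(R) = (F)`.
Hence, if a real projective transformation `φ` with matrix `g` maps `R` into `S`, then `G ∘ g`
vanishes on `R`, so `F` divides `G ∘ g`, and this divisibility gives `φ(R_ℂ) ⊆ S_ℂ`. The converse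
is restriction to real points, and applying both to `φ⁻¹` as well gives equality of the images.
-/

open MvPolynomial

namespace SimSurf

section Polynomial

variable {σ R S : Type*}

theorem eval_smul_of_isHomogeneous [CommSemiring R] {F : MvPolynomial σ R} {m : ℕ}
    (hF : F.IsHomogeneous m) (c : R) (v : σ → R) : eval (c • v) F = c ^ m * eval v F := by
  rw [eval_eq, eval_eq, Finset.mul_sum]
  refine Finset.sum_congr rfl fun d hd => ?_
  have sum_exponents : ∑ i ∈ d.support, d i = m := by
    rw [← hF (mem_support_iff.mp hd), Pi.one_def, ← Finsupp.degree_eq_weight_one,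
      Finsupp.degree_apply]
  simp only [Pi.smul_apply, smul_eq_mul, mul_pow, Finset.prod_mul_distrib,
    Finset.prod_pow_eq_pow_sum, sum_exponents]
  ring

theorem eval_bind₁_toMvPolynomial [CommSemiring R] {m n : Type*} [Fintype n] (M : Matrix m n R)
    (F : MvPolynomial m R) (v : n → R) :
    eval v (bind₁ M.toMvPolynomial F) = eval (M.mulVec v) F := by
  rw [← aeval_eq_eval, aeval_bind₁]
  simp only [aeval_eq_eval, Matrix.toMvPolynomial_eval_eq_apply]

theorem map_bind₁_toMvPolynomial [CommSemiring R] [CommSemiring S] {m n : Type*}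
    [Fintype n] (f : R →+* S) (M : Matrix m n R) (F : MvPolynomial m R) :
    map f (bind₁ M.toMvPolynomial F) = bind₁ (M.map f).toMvPolynomial (map f F) := by
  simp only [map_bind₁, ← Matrix.toMvPolynomial_map]

theorem isLocalHom_map [CommRing R] [CommRing S] (f : R →+* S) [IsLocalHom f]
    (hf : Function.Injective f) :
    IsLocalHom (map f : MvPolynomial σ R →+* MvPolynomial σ S) where
  map_nonunit F h := by
    simpa only [isUnit_iff, coeff_map, isUnit_map_iff, IsNilpotent.map_iff hf] using h

theorem irreducible_of_irreducible_map [CommRing R] [CommRing S] (f : R →+* S) [IsLocalHom f]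
    (hf : Function.Injective f) {F : MvPolynomial σ R} (h : Irreducible (map f F)) :
    Irreducible F :=
  have := isLocalHom_map (σ := σ) f hf
  h.of_map

end Polynomial

theorem eq_span_singleton_of_ringKrullDim_quotient {A : Type*} [CommRing A] [IsDomain A] {d : ℕ}
    {p : A} {I : Ideal A} (hp : Prime p) (hpI : p ∈ I) (hA : ringKrullDim A ≤ d + 1)
    (hI : d ≤ ringKrullDim (A ⧸ I)) : I = Ideal.span {p} := by
  have hle : Ideal.span {p} ≤ I := (Ideal.span_singleton_le_iff_mem _).mpr hpI
  refine le_antisymm (fun a ha => ?_) hle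
  by_contra hap
  have : (Ideal.span {p}).IsPrime := (Ideal.span_singleton_prime hp.ne_zero).mpr hp
  have ha0 : Ideal.Quotient.mk (Ideal.span {p}) a ≠ 0 := by
    rwa [Ne, Ideal.Quotient.eq_zero_iff_mem]
  have hdim : (d : WithBot ℕ∞) + 1 + 1 ≤ d + 1 := calc
    (d : WithBot ℕ∞) + 1 + 1 ≤ ringKrullDim (A ⧸ I) + 1 + 1 := by gcongr
    _ ≤ ringKrullDim (A ⧸ Ideal.span {p}) + 1 := by
      gcongr
      exact ringKrullDim_succ_le_of_surjective (Ideal.Quotient.factor hle)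
        (Ideal.Quotient.factor_surjective hle) (mem_nonZeroDivisors_of_ne_zero ha0)
        (by rwa [Ideal.Quotient.factor_mk, Ideal.Quotient.eq_zero_iff_mem])
    _ ≤ ringKrullDim A := ringKrullDim_quotient_succ_le_of_nonZeroDivisor
      (mem_nonZeroDivisors_of_ne_zero hp.ne_zero)
    _ ≤ d + 1 := hA
  norm_cast at hdim
  lia

section ZeroLocus

variable {K : Type*} [Field K]

theorem mk_mem_zeroLocus {F : MvPolynomial (Fin 4) K} {m : ℕ} (hF : F.IsHomogeneous m)
    {v : Fin 4 → K} (hv : v ≠ 0) :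
    Projectivization.mk K v hv ∈ zeroLocus F ↔ eval v F = 0 := by
  refine ⟨fun h => h v hv rfl, fun h w hw hwv => ?_⟩
  obtain ⟨c, rfl⟩ := (Projectivization.mk_eq_mk_iff' K w v hw hv).mp hwv
  rw [eval_smul_of_isHomogeneous hF, h, mul_zero]

theorem zeroLocus_subset_of_dvd {F H : MvPolynomial (Fin 4) K} (h : F ∣ H) :
    zeroLocus F ⊆ zeroLocus H :=
  fun _ hp v hv hvp => zero_dvd_iff.mp (hp v hv hvp ▸ map_dvd (eval v) h)

theorem zeroLocus_subset_of_zeroLocus_map_subset {L : Type*} [Field L] (f : K →+* L)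
    {F H : MvPolynomial (Fin 4) K} {m : ℕ} (hF : F.IsHomogeneous m)
    (h : zeroLocus (map f F) ⊆ zeroLocus (map f H)) : zeroLocus F ⊆ zeroLocus H := by
  rintro p hp v hv hvp
  have hfv : f ∘ v ≠ 0 := fun h0 =>
    hv (funext fun i => (map_eq_zero f).mp (congrFun h0 i))
  have hvF : eval (f ∘ v) (map f F) = 0 := by rw [← map_eval, hp v hv hvp, map_zero]
  have hvH : eval (f ∘ v) (map f H) = 0 := h ((mk_mem_zeroLocus (hF.map f) hfv).mpr hvF) _ hfv rfl
  rwa [← map_eval, map_eq_zero] at hvH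

theorem zeroLocus_bind₁_toMvPolynomial (g : GL (Fin 4) K) (F : MvPolynomial (Fin 4) K) :
    zeroLocus (bind₁ g.val.toMvPolynomial F) =
      (Matrix.ProjGenLinGroup.mk g : PGL(4, K))⁻¹ • zeroLocus F := by
  ext p
  rw [Set.mem_inv_smul_set_iff]
  refine ⟨fun h w hw hwp => ?_, fun h v hv hvp => ?_⟩
  · have hw' : g⁻¹ • w ≠ 0 := (smul_ne_zero_iff_ne g⁻¹).mpr hw
    have hp : Projectivization.mk K (g⁻¹ • w) hw' = p := by
      rw [← inv_smul_smul (Matrix.ProjGenLinGroup.mk g : PGL(4, K)) p, ← hwp]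
      rfl
    have hcancel : g.val.mulVec (g⁻¹ • w) = w := smul_inv_smul g w
    simpa only [eval_bind₁_toMvPolynomial, hcancel] using h _ hw' hp
  · rw [eval_bind₁_toMvPolynomial]
    exact h _ ((smul_ne_zero_iff_ne g).mpr hv) (by rw [← hvp]; rfl)

end ZeroLocus

section Surface

variable {F G H : MvPolynomial (Fin 4) ℝ}

theorem complexSurface_bind₁_toMvPolynomial (g : GL (Fin 4) ℝ) (F : MvPolynomial (Fin 4) ℝ) :
    complexSurface (bind₁ g.val.toMvPolynomial F) =
      (Matrix.ProjGenLinGroup.mk g : PGL(4, ℝ))⁻¹ • complexSurface F := by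
  rw [complexSurface, map_bind₁_toMvPolynomial]
  exact zeroLocus_bind₁_toMvPolynomial (Matrix.GeneralLinearGroup.map Complex.ofRealHom g) _

theorem mem_vanishingIdeal_coneOver_iff {X : Set (P3 ℝ)} :
    H ∈ vanishingIdeal ℝ (coneOver X) ↔ X ⊆ realSurface H := by
  rw [mem_vanishingIdeal_iff]
  constructor
  · rintro h p hp v hv rfl
    exact h v ⟨hv, hp⟩
  · rintro h v ⟨hv, hvX⟩
    exact h hvX v hv rfl

theorem vanishingIdeal_coneOver_realSurface (hF : Irreducible F)
    (hR : HasRealDim (realSurface F) 2) :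
    vanishingIdeal ℝ (coneOver (realSurface F)) = Ideal.span {F} := by
  refine eq_span_singleton_of_ringKrullDim_quotient (d := 3) hF.prime
    (mem_vanishingIdeal_coneOver_iff.mpr subset_rfl) ?_ ?_
  · rw [MvPolynomial.ringKrullDim_of_isNoetherianRing]
    norm_num
  · rw [hR]
    norm_num

theorem realSurface_subset_iff_dvd (hF : Irreducible F) (hR : HasRealDim (realSurface F) 2) :
    realSurface F ⊆ realSurface H ↔ F ∣ H := by
  rw [← mem_vanishingIdeal_coneOver_iff, vanishingIdeal_coneOver_realSurface hF hR,
    Ideal.mem_span_singleton]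

theorem complexSurface_subset_iff {m : ℕ} (hFhom : F.IsHomogeneous m) (hF : Irreducible F)
    (hR : HasRealDim (realSurface F) 2) :
    complexSurface F ⊆ complexSurface H ↔ realSurface F ⊆ realSurface H := by
  refine ⟨zeroLocus_subset_of_zeroLocus_map_subset _ hFhom, fun h => ?_⟩
  exact zeroLocus_subset_of_dvd (map_dvd _ ((realSurface_subset_iff_dvd hF hR).mp h))

theorem smul_complexSurface_subset_iff {m : ℕ} (hFhom : F.IsHomogeneous m) (hF : Irreducible F)
    (hR : HasRealDim (realSurface F) 2) (φ : PGL(4, ℝ)) :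
    φ • complexSurface F ⊆ complexSurface G ↔ φ • realSurface F ⊆ realSurface G := by
  induction φ using Matrix.ProjGenLinGroup.induction_on with | mk g =>
  have real_pullback : (Matrix.ProjGenLinGroup.mk g : PGL(4, ℝ))⁻¹ • realSurface G =
      realSurface (bind₁ g.val.toMvPolynomial G) := (zeroLocus_bind₁_toMvPolynomial g G).symm
  rw [Set.smul_set_subset_iff_subset_inv_smul_set, Set.smul_set_subset_iff_subset_inv_smul_set,
    ← complexSurface_bind₁_toMvPolynomial, real_pullback, complexSurface_subset_iff hFhom hF hR]

end Surface

end SimSurf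

theorem mainTheorem6_general {F G : MvPolynomial (Fin 4) ℝ} {m n : ℕ}
    (hF : F.IsHomogeneous m) (hG : G.IsHomogeneous n)
    (hFirr : Irreducible F) (hGirr : Irreducible G)
    (hR : SimSurf.HasRealDim (SimSurf.realSurface F) 2)
    (hS : SimSurf.HasRealDim (SimSurf.realSurface G) 2) (𝓖 : Set PGL(4, ℝ)) :
    SimSurf.equivalences 𝓖 (SimSurf.complexSurface F) (SimSurf.complexSurface G) =
      SimSurf.equivalences 𝓖 (SimSurf.realSurface F) (SimSurf.realSurface G) := by
  ext φ
  refine and_congr_right fun _ => ?_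
  simp only [Set.Subset.antisymm_iff, Set.subset_smul_set_iff,
    SimSurf.smul_complexSurface_subset_iff hF hFirr hR,
    SimSurf.smul_complexSurface_subset_iff hG hGirr hS]

theorem mainTheorem6 (F G : MvPolynomial (Fin 4) ℝ) (m n : ℕ)
    (hF : F.IsHomogeneous m) (hG : G.IsHomogeneous n)
    (hFirr : Irreducible (MvPolynomial.map (algebraMap ℝ ℂ) F))
    (hGirr : Irreducible (MvPolynomial.map (algebraMap ℝ ℂ) G))
    (hR : SimSurf.HasRealDim (SimSurf.realSurface F) 2)
    (hS : SimSurf.HasRealDim (SimSurf.realSurface G) 2) :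
    SimSurf.equivalences SimSurf.directSimilarities
        (SimSurf.complexSurface F) (SimSurf.complexSurface G) =
      SimSurf.equivalences SimSurf.directSimilarities
        (SimSurf.realSurface F) (SimSurf.realSurface G) ∧
    SimSurf.equivalences SimSurf.similarities
        (SimSurf.complexSurface F) (SimSurf.complexSurface G) =
      SimSurf.equivalences SimSurf.similarities
        (SimSurf.realSurface F) (SimSurf.realSurface G) := by
  have hF_real : Irreducible F :=
    SimSurf.irreducible_of_irreducible_map _ (algebraMap ℝ ℂ).injective hFirr
  have hG_real : Irreducible G :=
    SimSurf.irreducible_of_irreducible_map _ (algebraMap ℝ ℂ).injective hGirr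
  exact ⟨mainTheorem6_general hF hG hF_real hG_real hR hS _,
    mainTheorem6_general hF hG hF_real hG_real hR hS _⟩
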